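/- Let $n,k\ge 1$. An $n\times k$ indicator matrix is a real matrix $X$ that encodes a partition of $n$ points into $k$ non-empty clusters: $X_{ij}=1/\sqrt{z_j}$ if point $i$ belongs to cluster $j$ and $X_{ij}=0$ otherwise, where $z_j\ge 1$ is the size of cluster $j$ and every point belongs to exactly one cluster (so $X^\top X=I_k$). The $k$-means cost of $X$ on a matrix $B\in\mathbb{R}^{n\times m}$, whose rows are the points, is $\|B-XX^\top B\|_F^2$; $X$ is optimal for $B$ if it minimizes this cost among all $n\times k$ indicator matrices. For $\gamma\ge 1$ and $\delta_\gamma\in[0,1)$, a $\gamma$-approximation $k$-means algorithm with failure probability $\delta_\gamma$ is a randomized algorithm that on every input $B$ returns an $n\times k$ indicator matrix $X$ such that, with probability at least $1-\delta_\gamma$ over its own randomness, $\|B-XX^\top B\|_F^2\le\gamma\min_{Y}\|B-YY^\top B\|_F^2$, the minimum being over all $n\times k$ indicator matrices $Y$. **Theorem.** There is an absolute constant $c>0$ such that the following holds for every $A\in\mathbb{R}^{n\times d}$, every positive integer $k<\min\{n,d\}$, every $\varepsilon\in(0,1/3)$ and every integer $t\ge ck/\varepsilon^2$. Let $R$ be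 a random $d\times t$ matrix with independent entries, each equal to $+1/\sqrt t$ or $-1/\sqrt t$ with probability $1/2$. 1. Let $\gamma\ge1$ and $\delta_\gamma\in[0,1)$, let $X_{\mathrm{opt}}$ be optimal for $A$, and let $X$ be the indicator matrix returned by a $\gamma$-approximation $k$-means algorithm with failure probability $\delta_\gamma$, run (with randomness independent of $R$) on $AR$. Then, with probability at least $0.97-\delta_\gamma$, $$\|A-XX^\top A\|_F^2\le\bigl(1+(1+\varepsilon)\gamma\bigr)\,\|A-X_{\mathrm{opt}}X_{\mathrm{opt}}^\top A\|_F^2 .$$ 2. In particular, with probability at least $0.97$ over $R$, every indicator matrix $X$ that is optimal for $AR$ satisfies $\|A-XX^\top A\|_F^2\le(2+\varepsilon)\,\|A-X_{\mathrm{opt}}X_{\mathrm{opt}}^\top A\|_F^2$ for every $X_{\mathrm{opt}}$ that is optimal for $A$. -/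

import Mathlib

open Matrix

noncomputable section

namespace KMeansRP

/-- The points (rows) that belong to the `j`-th cluster of `X`. -/
def cluster {n k : ℕ} (X : Matrix (Fin n) (Fin k) ℝ) (j : Fin k) : Set (Fin n) :=
  {i | X i j ≠ 0}

/-- `n × k` (normalized) cluster indicator matrices: every row has exactly one non-zero entry, the
non-zero entries of column `j` are `1 / √z_j`, where `z_j` is the size of the `j`-th cluster, and no
cluster is empty, so that `Xᵀ * X = 1`. -/
structure IsIndicator {n k : ℕ} (X : Matrix (Fin n) (Fin k) ℝ) : Prop where
  existsUnique_ne_zero : ∀ i, ∃! j, X i j ≠ 0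
  entry_eq : ∀ i j, X i j ≠ 0 → X i j = 1 / √((cluster X j).ncard : ℝ)
  cluster_nonempty : ∀ j, (cluster X j).Nonempty

/-- The set of all `n × k` indicator matrices. -/
abbrev Indicator (n k : ℕ) : Type := {X : Matrix (Fin n) (Fin k) ℝ // IsIndicator X}

section Cost

attribute [local instance] Matrix.frobeniusNormedAddCommGroup

/-- The `k`-means objective `F(A, X) = ‖A - X Xᵀ A‖_F²` (Frobenius norm). -/
def cost {n m k : ℕ} (A : Matrix (Fin n) (Fin m) ℝ) (X : Indicator n k) : ℝ :=
  ‖A - X.1 * X.1ᵀ * A‖ ^ 2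

end Cost

/-- `X` is an optimal `k`-means clustering of the rows of `A`. -/
def IsOptimal {n m k : ℕ} (A : Matrix (Fin n) (Fin m) ℝ) (X : Indicator n k) : Prop :=
  ∀ Y : Indicator n k, cost A X ≤ cost A Y

/-- The probability of the event `S` under the discrete law `p`, as a real number. -/
def prob {α : Type*} (p : PMF α) (S : Set α) : ℝ := (p.toOuterMeasure S).toReal

/-- A randomized clustering algorithm on `n` points in `m` dimensions with `k` clusters: to each
input it assigns the law of the indicator matrix that it returns. -/
abbrev Algorithm (n m k : ℕ) : Type := Matrix (Fin n) (Fin m) ℝ → PMF (Indicator n k)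

/-- On every input, with probability at least `1 - δ` over its own randomness, the algorithm returns
a clustering whose cost is at most `γ` times the minimal cost. -/
def IsApproximation {n m k : ℕ} (alg : Algorithm n m k) (γ δ : ℝ) : Prop :=
  ∀ B : Matrix (Fin n) (Fin m) ℝ,
    1 - δ ≤ prob (alg B) {X | ∀ Y : Indicator n k, cost B X ≤ γ * cost B Y}

/-- The law of a random `d × t` matrix with independent entries, each of them `+1/√t` or `-1/√t`
with probability `1/2`; that is, all `2 ^ (d * t)` sign patterns are equally likely. -/
def signMatrix (d t : ℕ) : PMF (Matrix (Fin d) (Fin t) ℝ) :=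
  (PMF.uniformOfFintype (Fin d → Fin t → Bool)).map
    fun s => Matrix.of fun i j => if s i j then 1 / √(t : ℝ) else -(1 / √(t : ℝ))

/-- The random projection algorithm: draw a random `d × t` sign matrix `R`, then run `alg` (with
fresh randomness) on `A * R`. This is the law of the returned indicator matrix. -/
def projectAndCluster {n d t k : ℕ} (alg : Algorithm n t k) (A : Matrix (Fin n) (Fin d) ℝ) :
    PMF (Indicator n k) :=
  (signMatrix d t).bind fun R => alg (A * R)

/-- Replacing the rows of `A` by those of `B` preserves the `k`-clustering structure within a factor
`φ`: every optimal clustering of `B` is, as a clustering of `A`, at most a factor `φ` worse than an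
optimal clustering of `A`. -/
def PreservesClustering {n d m : ℕ} (k : ℕ) (A : Matrix (Fin n) (Fin d) ℝ)
    (B : Matrix (Fin n) (Fin m) ℝ) (φ : ℝ) : Prop :=
  ∀ X Xopt : Indicator n k, IsOptimal B X → IsOptimal A Xopt → cost A X ≤ φ * cost A Xopt

end KMeansRP

end

/-! Let `V` be the span of the centroids of `Xopt`, of dimension at most `k`, let `P` be the
projection onto it, `F = cost A Xopt`, `b = a - P a` for the rows `a` of `A`, and `L` the sketch.
For a clustering `X` with residuals `m = (1 - X Xᵀ) a`, Pythagoras splits `‖m‖²` into `‖P m‖²` and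
the norm outside `V`. The outer part is `(1 - X Xᵀ) b`; since `1 - X Xᵀ` is a contraction and the
points `X₀ X₀ᵀ a`, `X₀ = Xopt`, lie in `V`, it is at most `‖b‖² ≤ F`. This is the `1` in `1 + (1 +
ε) γ`.

The part in `V` is seen through the sketch: `‖L P m‖² = ⟨L P m, L m⟩ - ⟨L P m, L (1 - X Xᵀ) b⟩`,
where `‖L m‖²` is the sketched cost of `X`. With `e = ε / 10`, three events give `‖P m‖² ≤ (1 + 10
e) γ F`: `L` is nearly isometric on `V`, it nearly preserves the orthogonality of `V` and `b`, and
it does not inflate the residuals of `Xopt` much. None of them mentions `X`, so no union bound over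
clusterings is needed. The deterministic step is `sum_norm_sq_residual_le_of_sketch`.

Each event fails with probability at most `0.01`. All three rest on the exponential moment bound
`expect_exp_distortion_le`: its tail estimate and a net of `V` give the near-isometry, its second
moment estimate and Markov's inequality give the other two (`le_prob_goodSketches`). -/

namespace KMeansRP

open Finset BigOperators

/-! ### Rademacher sums -/

section Rademacher

variable {ι κ : Type*} [Fintype ι] [Fintype κ] [DecidableEq ι]

/-- The expectation of a product of functions of independent uniform coordinates is the product of
the expectations. -/
lemma expect_prod_pi (f : ι → κ → ℝ) :
    𝔼 s : ι → κ, ∏ i, f i (s i) = ∏ i, 𝔼 b, f i b := by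
  simp only [Fintype.expect_eq_sum_div_card, prod_div_distrib, prod_univ_sum,
    Fintype.piFinset_univ, Fintype.card_fun, prod_const, card_univ, Nat.cast_pow]

/-- The sign `1` or `-1` encoded by a Boolean. -/
def sign (b : Bool) : ℝ := if b then 1 else -1

/-- The signed sum `∑ i, ± x i`. -/
def signedSum (x : ι → ℝ) (s : ι → Bool) : ℝ := ∑ i, x i * sign (s i)

lemma expect_bool (f : Bool → ℝ) : 𝔼 b, f b = (f true + f false) / 2 := by
  rw [Fintype.expect_eq_sum_div_card, Fintype.sum_bool, Fintype.card_bool, Nat.cast_ofNat]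

lemma expect_sign_mul_sign (i j : ι) :
    𝔼 s : ι → Bool, sign (s i) * sign (s j) = if i = j then 1 else 0 := by
  -- Written as a product over all coordinates, with trivial factors away from `i` and `j`, the
  -- expectation factors. If `i ≠ j`, the factor at `i` has mean zero.
  have h : ∀ s : ι → Bool, sign (s i) * sign (s j) =
      ∏ l, (if l = i then sign (s l) else 1) * (if l = j then sign (s l) else 1) := by
    intro s
    rw [prod_mul_distrib]
    simp
  simp only [h]
  rw [expect_prod_pi fun l b => (if l = i then sign b else 1) * (if l = j then sign b else 1)]
  split_ifs with hij
  · subst hij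
    refine prod_eq_one fun l _ => ?_
    rw [expect_bool]
    by_cases hl : l = i <;> simp [hl, sign]
  · refine prod_eq_zero (mem_univ i) ?_
    rw [expect_bool]
    simp [hij, sign]

lemma expect_signedSum_mul_signedSum (x y : ι → ℝ) :
    𝔼 s, signedSum x s * signedSum y s = ∑ i, x i * y i := by
  have h : ∀ s : ι → Bool, signedSum x s * signedSum y s =
      ∑ i, ∑ j, x i * y j * (sign (s i) * sign (s j)) := by
    intro s
    rw [signedSum, signedSum, sum_mul_sum]
    exact sum_congr rfl fun i _ => sum_congr rfl fun j _ => by ring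
  simp only [h, expect_sum_comm, ← mul_expect, expect_sign_mul_sign]
  simp

lemma expect_exp_mul_signedSum_le (x : ι → ℝ) (r : ℝ) :
    𝔼 s, Real.exp (r * signedSum x s) ≤ Real.exp (r ^ 2 * (∑ i, x i ^ 2) / 2) := by
  have h : ∀ s : ι → Bool, Real.exp (r * signedSum x s) =
      ∏ i, Real.exp (r * (x i * sign (s i))) := by
    intro s
    rw [signedSum, mul_sum, Real.exp_sum]
  simp only [h]
  rw [expect_prod_pi fun i b => Real.exp (r * (x i * sign b)), mul_sum, sum_div, Real.exp_sum]
  refine prod_le_prod (fun i _ => expect_nonneg fun b _ => (Real.exp_pos _).le) fun i _ => ?_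
  rw [expect_bool]
  have := Real.cosh_le_exp_half_sq (r * x i)
  rw [Real.cosh_eq] at this
  simp only [sign, if_true, mul_one, Bool.false_eq_true, if_false, mul_neg]
  rwa [← mul_pow]

open MeasureTheory in
lemma integral_exp_linear_sub_sq (a : ℝ) :
    Integrable (fun g : ℝ => Real.exp (a * g - g ^ 2 / 2)) ∧
      ∫ g : ℝ, Real.exp (a * g - g ^ 2 / 2) = Real.exp (a ^ 2 / 2) * √(2 * Real.pi) := by
  have h : (fun g : ℝ => Real.exp (a * g - g ^ 2 / 2)) =
      fun g => Real.exp (a ^ 2 / 2) * Real.exp (-(1 / 2) * (g - a) ^ 2) := by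
    funext g
    rw [← Real.exp_add]
    ring_nf
  rw [h]
  have hint := integrable_exp_neg_mul_sq (by norm_num : (0 : ℝ) < 1 / 2)
  refine ⟨(hint.comp_sub_right a).const_mul _, ?_⟩
  rw [integral_const_mul, integral_sub_right_eq_self fun g => Real.exp (-(1 / 2) * g ^ 2),
    integral_gaussian]
  congr 2
  ring

open MeasureTheory in
/-- Exponential square integrability of a signed sum, by linearizing the square in the exponent with
an auxiliary Gaussian variable. -/
lemma expect_exp_signedSum_sq_le {x : ι → ℝ} (hx : ∑ i, x i ^ 2 ≤ 1) :
    𝔼 s, Real.exp (signedSum x s ^ 2 / 4) ≤ √2 := by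
  -- For a standard Gaussian `g`, `exp (S ^ 2 / 4)` is the mean of `exp (σ * S * g)` because `σ ^ 2
  -- = 1 / 2`. Averaging over signs first leaves at most `exp (g ^ 2 / 4)` against the weight `exp
  -- (-g ^ 2 / 2)`.
  set σ : ℝ := 1 / √2 with hσ
  have hσ2 : σ ^ 2 = 1 / 2 := by rw [hσ, div_pow, Real.sq_sqrt (by norm_num)]; norm_num
  have hπ : (0 : ℝ) < √(2 * Real.pi) := Real.sqrt_pos.2 (by positivity)
  have hint : ∀ s : ι → Bool,
      Integrable (fun g : ℝ => Real.exp (σ * signedSum x s * g - g ^ 2 / 2)) := fun s =>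
    (integral_exp_linear_sub_sq _).1
  have hval : ∀ s : ι → Bool, Real.exp (signedSum x s ^ 2 / 4) * √(2 * Real.pi) =
      ∫ g : ℝ, Real.exp (σ * signedSum x s * g - g ^ 2 / 2) := by
    intro s
    rw [(integral_exp_linear_sub_sq _).2, mul_pow, hσ2]
    ring_nf
  have hle : (𝔼 s, Real.exp (signedSum x s ^ 2 / 4)) * √(2 * Real.pi) ≤
      ∫ g : ℝ, Real.exp (-(1 / 4) * g ^ 2) := by
    rw [expect_mul]
    simp only [hval]
    rw [Fintype.expect_eq_sum_div_card, ← integral_finsetSum _ fun s _ => hint s,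
      ← integral_div]
    refine integral_mono ((integrable_finsetSum _ fun s _ => hint s).div_const _)
      (integrable_exp_neg_mul_sq (by norm_num)) fun g => ?_
    dsimp only
    rw [← Fintype.expect_eq_sum_div_card]
    have h1 : ∀ s : ι → Bool, Real.exp (σ * signedSum x s * g - g ^ 2 / 2) =
        Real.exp (σ * g * signedSum x s) * Real.exp (-g ^ 2 / 2) := by
      intro s
      rw [← Real.exp_add]
      ring_nf
    simp only [h1]
    rw [← expect_mul]
    refine (mul_le_mul_of_nonneg_right (expect_exp_mul_signedSum_le x (σ * g))
      (Real.exp_pos _).le).trans ?_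
    rw [← Real.exp_add, Real.exp_le_exp, mul_pow, hσ2]
    nlinarith [mul_le_mul_of_nonneg_left hx (sq_nonneg g)]
  rw [integral_gaussian] at hle
  have : √(Real.pi / (1 / 4)) = √2 * √(2 * Real.pi) := by
    rw [← Real.sqrt_mul (by norm_num)]
    congr 1
    ring
  rw [this] at hle
  exact le_of_mul_le_mul_right hle hπ

/-- The linear term is kept exact so that it vanishes in the mean for a centred variable, leaving a
moment generating function bound quadratic in the parameter. -/
lemma exp_le_one_add_add_sq_mul_exp_abs (u : ℝ) :
    Real.exp u ≤ 1 + u + u ^ 2 * Real.exp |u| := by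
  have h1 : 1 ≤ Real.exp |u| := Real.one_le_exp (abs_nonneg u)
  have h2 : u ^ 2 ≤ u ^ 2 * Real.exp |u| := le_mul_of_one_le_right (sq_nonneg u) h1
  rcases le_or_gt |u| 1 with h | h
  · have := (abs_le.1 (Real.abs_exp_sub_one_sub_id_le h)).2
    linarith
  · rcases lt_abs.1 h with h | h
    · have h3 : Real.exp u ≤ Real.exp |u| := Real.exp_le_exp.2 (le_abs_self u)
      have h4 : Real.exp |u| ≤ u ^ 2 * Real.exp |u| :=
        le_mul_of_one_le_left (Real.exp_pos _).le (one_le_pow₀ h.le)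
      linarith
    · have : Real.exp u ≤ 1 := Real.exp_le_one_iff.2 (by linarith)
      nlinarith

/-- The centred product of two signed sums with the same signs. -/
def centeredProd (x y : ι → ℝ) (s : ι → Bool) : ℝ :=
  signedSum x s * signedSum y s - ∑ i, x i * y i

lemma expect_centeredProd (x y : ι → ℝ) : 𝔼 s, centeredProd x y s = 0 := by
  simp only [centeredProd, expect_sub_distrib, expect_signedSum_mul_signedSum,
    Fintype.expect_const, sub_self]

lemma expect_sq_mul_exp_centeredProd_le {x y : ι → ℝ} (hx : ∑ i, x i ^ 2 ≤ 1)
    (hy : ∑ i, y i ^ 2 ≤ 1) :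
    𝔼 s, centeredProd x y s ^ 2 * Real.exp (|centeredProd x y s| / 8) ≤ 400 := by
  have hxy : |∑ i, x i * y i| ≤ 1 := by
    refine abs_le_of_sq_le_sq ?_ zero_le_one
    refine (sum_mul_sq_le_sq_mul_sq univ x y).trans ?_
    rw [one_pow]
    exact mul_le_one₀ hx (sum_nonneg fun i _ => sq_nonneg _) hy
  have h4 : Real.exp (1 / 4) ≤ 4 / 3 := by
    have := Real.exp_bound_div_one_sub_of_interval (x := 1 / 4) (by norm_num) (by norm_num)
    norm_num at this ⊢
    exact this
  -- The polynomial factor costs `128 * exp (|w| / 8)`; then `|w| / 4 ≤ (a ^ 2 + b ^ 2) / 8 + 1 /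
  -- 4`, and AM-GM separates `a` from `b`. The constant is `128 * (4 / 3) / 2`.
  have key : ∀ s, centeredProd x y s ^ 2 * Real.exp (|centeredProd x y s| / 8) ≤
      256 / 3 * (Real.exp (signedSum x s ^ 2 / 4) + Real.exp (signedSum y s ^ 2 / 4)) := by
    intro s
    set a := signedSum x s
    set b := signedSum y s
    set w := centeredProd x y s with hw
    have hwle : |w| ≤ (a ^ 2 + b ^ 2) / 2 + 1 := by
      have h1 : |w| ≤ |a * b| + |∑ i, x i * y i| := abs_sub _ _
      have h2 : |a * b| ≤ (a ^ 2 + b ^ 2) / 2 := by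
        rw [abs_mul, ← sq_abs a, ← sq_abs b]
        nlinarith [sq_nonneg (|a| - |b|)]
      linarith
    have h1 : w ^ 2 ≤ 128 * Real.exp (|w| / 8) := by
      have := Real.quadratic_le_exp_of_nonneg (x := |w| / 8) (by positivity)
      rw [div_pow, sq_abs] at this
      nlinarith [abs_nonneg w]
    have h2 : w ^ 2 * Real.exp (|w| / 8) ≤ 128 * Real.exp (|w| / 4) := by
      calc w ^ 2 * Real.exp (|w| / 8) ≤ 128 * Real.exp (|w| / 8) * Real.exp (|w| / 8) :=
            mul_le_mul_of_nonneg_right h1 (Real.exp_pos _).le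
        _ = 128 * Real.exp (|w| / 4) := by
            rw [mul_assoc, ← Real.exp_add]
            ring_nf
    have h3 : Real.exp (|w| / 4) ≤
        Real.exp (1 / 4) * (Real.exp (a ^ 2 / 8) * Real.exp (b ^ 2 / 8)) := by
      rw [← Real.exp_add, ← Real.exp_add, Real.exp_le_exp]
      linarith
    have h5 : Real.exp (a ^ 2 / 4) = Real.exp (a ^ 2 / 8) ^ 2 := by
      rw [← Real.exp_nat_mul]; push_cast; ring_nf
    have h6 : Real.exp (b ^ 2 / 4) = Real.exp (b ^ 2 / 8) ^ 2 := by
      rw [← Real.exp_nat_mul]; push_cast; ring_nf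
    rw [h5, h6]
    have h7 : 0 ≤ Real.exp (a ^ 2 / 8) * Real.exp (b ^ 2 / 8) := by positivity
    have h8 := mul_le_mul_of_nonneg_right h4 h7
    nlinarith [sq_nonneg (Real.exp (a ^ 2 / 8) - Real.exp (b ^ 2 / 8))]
  refine (expect_le_expect fun s _ => key s).trans ?_
  rw [← mul_expect, expect_add_distrib]
  have h2 : √2 ≤ 1.5 := Real.sqrt_le_iff.2 (by norm_num)
  have := expect_exp_signedSum_sq_le hx
  have := expect_exp_signedSum_sq_le hy
  linarith

lemma expect_exp_mul_centeredProd_le {x y : ι → ℝ} (hx : ∑ i, x i ^ 2 ≤ 1)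
    (hy : ∑ i, y i ^ 2 ≤ 1) {r : ℝ} (hr : |r| ≤ 1 / 8) :
    𝔼 s, Real.exp (r * centeredProd x y s) ≤ Real.exp (400 * r ^ 2) := by
  have key : ∀ s, Real.exp (r * centeredProd x y s) ≤ 1 + r * centeredProd x y s +
      r ^ 2 * (centeredProd x y s ^ 2 * Real.exp (|centeredProd x y s| / 8)) := by
    intro s
    refine (exp_le_one_add_add_sq_mul_exp_abs _).trans ?_
    have : Real.exp |r * centeredProd x y s| ≤ Real.exp (|centeredProd x y s| / 8) := by
      rw [Real.exp_le_exp, abs_mul]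
      nlinarith [abs_nonneg (centeredProd x y s)]
    rw [mul_pow, mul_assoc]
    gcongr
  refine (expect_le_expect fun s _ => key s).trans ?_
  rw [expect_add_distrib, expect_add_distrib, ← mul_expect, ← mul_expect, expect_centeredProd,
    Fintype.expect_const]
  have := mul_le_mul_of_nonneg_left (expect_sq_mul_exp_centeredProd_le hx hy) (sq_nonneg r)
  have := Real.add_one_le_exp (400 * r ^ 2)
  linarith

end Rademacher

/-! ### Nets and operator norms -/

section Net

variable {E F : Type*} [NormedAddCommGroup E] [NormedSpace ℝ E] [NormedAddCommGroup F]
  [NormedSpace ℝ F]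

variable (E) in
/-- The ball of radius `2` in a `k`-dimensional normed space has a `1`-net with at most `5 ^ k`
points. -/
lemma exists_net_card_le [FiniteDimensional ℝ E] :
    ∃ s : Finset E, s.card ≤ 5 ^ Module.finrank ℝ E ∧ (∀ c ∈ s, ‖c‖ ≤ 2) ∧
      ∀ u : E, ‖u‖ ≤ 2 → ∃ c ∈ s, ‖u - c‖ ≤ 1 := by
  classical
  -- A `1`-separated set of maximal cardinality is a net: a point far from all of it could be added.
  -- The volume bound `5 ^ k` makes the maximum exist.
  let p : ℕ → Prop := fun m => ∃ s : Finset E, s.card = m ∧ (∀ c ∈ s, ‖c‖ ≤ 2) ∧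
    ∀ c ∈ s, ∀ d ∈ s, c ≠ d → 1 ≤ ‖c - d‖
  have hp : p 0 := ⟨∅, by simp⟩
  obtain ⟨s, hcard, hs2, hs⟩ : p (Nat.findGreatest p (5 ^ Module.finrank ℝ E)) :=
    Nat.findGreatest_spec (Nat.zero_le _) hp
  refine ⟨s, Besicovitch.card_le_of_separated s hs2 hs, hs2, fun u hu => ?_⟩
  by_contra! hfar
  have hus : u ∉ s := fun h => by simpa using (hfar u h).trans_le' zero_le_one
  have hins : (∀ c ∈ insert u s, ‖c‖ ≤ 2) ∧
      ∀ c ∈ insert u s, ∀ d ∈ insert u s, c ≠ d → 1 ≤ ‖c - d‖ := by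
    refine ⟨fun c hc => ?_, fun c hc d hd hcd => ?_⟩
    · rcases Finset.mem_insert.1 hc with rfl | hc
      exacts [hu, hs2 c hc]
    · rcases Finset.mem_insert.1 hc with rfl | hc' <;> rcases Finset.mem_insert.1 hd with rfl | hd'
      · exact absurd rfl hcd
      · exact (hfar d hd').le
      · rw [norm_sub_rev]
        exact (hfar c hc').le
      · exact hs c hc' d hd' hcd
  have hle := Besicovitch.card_le_of_separated (insert u s) hins.1 hins.2
  have := Nat.le_findGreatest (P := p) hle ⟨insert u s, rfl, hins⟩
  rw [Finset.card_insert_of_notMem hus] at this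
  omega

/-- Approximating a vector of norm `2` within `1` yields `2 * ‖f‖ ≤ m + ‖f‖`. Using radius `2` makes
the bound on the net pass to `‖f‖` with no loss, so it can be applied once per argument of a
bilinear form. -/
lemma opNorm_le_of_net {s : Finset E} (hs : ∀ u : E, ‖u‖ ≤ 2 → ∃ c ∈ s, ‖u - c‖ ≤ 1)
    (f : E →L[ℝ] F) {m : ℝ} (hm : 0 ≤ m) (hf : ∀ c ∈ s, ‖f c‖ ≤ m) : ‖f‖ ≤ m := by
  have h : ‖f‖ ≤ (m + ‖f‖) / 2 := by
    refine f.opNorm_le_bound (by positivity) fun x => ?_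
    rcases eq_or_ne x 0 with rfl | hx
    · simp
    have hx' : 0 < ‖x‖ := norm_pos_iff.2 hx
    obtain ⟨c, hc, hcu⟩ := hs ((2 / ‖x‖) • x) (by
      rw [norm_smul, Real.norm_of_nonneg (by positivity), div_mul_cancel₀ _ hx'.ne'])
    have h1 : ‖f ((2 / ‖x‖) • x)‖ ≤ m + ‖f‖ := by
      calc ‖f ((2 / ‖x‖) • x)‖ = ‖f c + f ((2 / ‖x‖) • x - c)‖ := by rw [map_sub]; congr 1; abel
        _ ≤ ‖f c‖ + ‖f ((2 / ‖x‖) • x - c)‖ := norm_add_le _ _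
        _ ≤ m + ‖f‖ * 1 := add_le_add (hf c hc) (f.le_opNorm_of_le hcu)
        _ = m + ‖f‖ := by rw [mul_one]
    rw [map_smul, norm_smul, Real.norm_of_nonneg (by positivity), div_mul_eq_mul_div,
      div_le_iff₀ hx'] at h1
    linarith
  linarith

lemma abs_bilin_le_of_net {s : Finset E} (hs : ∀ u : E, ‖u‖ ≤ 2 → ∃ c ∈ s, ‖u - c‖ ≤ 1)
    (f : E →L[ℝ] E →L[ℝ] ℝ) {m : ℝ} (hm : 0 ≤ m) (hf : ∀ c ∈ s, ∀ e ∈ s, |f c e| ≤ m) (x y : E) :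
    |f x y| ≤ m * ‖x‖ * ‖y‖ := by
  have h : ‖f‖ ≤ m := opNorm_le_of_net hs f hm fun c hc => opNorm_le_of_net hs (f c) hm (hf c hc)
  exact (f.le_opNorm₂ x y).trans (by gcongr)

end Net

/-! ### Frequencies in finite sample spaces -/

section Frequency

variable {Ω : Type*} [Fintype Ω]

open Classical in
/-- The probability of an event under the uniform distribution on a finite type. -/
noncomputable def freq (S : Set Ω) : ℝ := 𝔼 s, if s ∈ S then 1 else 0

lemma freq_mono {S T : Set Ω} (h : S ⊆ T) : freq S ≤ freq T := by
  refine expect_le_expect fun s _ => ?_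
  by_cases hs : s ∈ S
  · simp [hs, h hs]
  · rw [if_neg hs]
    split_ifs <;> norm_num

lemma freq_union_le (S T : Set Ω) : freq (S ∪ T) ≤ freq S + freq T := by
  rw [freq, freq, freq, ← expect_add_distrib]
  refine expect_le_expect fun s _ => ?_
  by_cases hs : s ∈ S <;> by_cases ht : s ∈ T <;> simp [hs, ht]

lemma freq_compl [Nonempty Ω] (S : Set Ω) : freq Sᶜ = 1 - freq S := by
  rw [eq_sub_iff_add_eq, freq, freq, ← expect_add_distrib, ← Fintype.expect_const (ι := Ω) (1 : ℝ)]
  refine expect_congr rfl fun s _ => ?_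
  by_cases hs : s ∈ S <;> simp [hs]

lemma freq_biUnion_le {ι : Type*} (I : Finset ι) (S : ι → Set Ω) :
    freq (⋃ i ∈ I, S i) ≤ ∑ i ∈ I, freq (S i) := by
  classical
  induction I using Finset.induction_on with
  | empty => simp [freq]
  | insert a I ha ih =>
    rw [set_biUnion_insert, sum_insert ha]
    exact (freq_union_le _ _).trans (by linarith)

/-- Markov's inequality. -/
lemma freq_lt_le {f : Ω → ℝ} (hf : ∀ s, 0 ≤ f s) {a κ : ℝ} (ha : 0 ≤ a) (hκ : 0 ≤ κ)
    (h : 𝔼 s, f s ≤ κ * a) : freq {s | a < f s} ≤ κ := by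
  -- Threshold `0` occurs when the families being sketched vanish. There `f` is identically zero and
  -- the strict inequality makes the event empty.
  rcases ha.eq_or_lt with rfl | ha
  · rw [mul_zero] at h
    have hz : ∀ s, f s = 0 := by
      have := le_antisymm h (expect_nonneg fun s _ => hf s)
      intro s
      exact (expect_eq_zero_iff_of_nonneg fun s _ => hf s).1 this s (mem_univ s)
    simpa [freq, hz] using hκ
  · refine le_of_mul_le_mul_right ?_ ha
    refine le_trans ?_ h
    rw [freq, expect_mul]
    refine expect_le_expect fun s _ => ?_
    split_ifs with hs
    · rw [one_mul]
      exact le_of_lt hs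
    · rw [zero_mul]
      exact hf s

end Frequency

/-! ### The random sign sketch -/

section Sketch

variable {d t : ℕ}

/-- The matrix with entries `± 1 / √t` given by a sign pattern. -/
noncomputable def signMat (s : Fin d → Fin t → Bool) : Matrix (Fin d) (Fin t) ℝ :=
  Matrix.of fun i j => if s i j then 1 / √(t : ℝ) else -(1 / √(t : ℝ))

/-- The linear map `x ↦ x R` on row vectors. -/
noncomputable def sketch (R : Matrix (Fin d) (Fin t) ℝ) :
    EuclideanSpace ℝ (Fin d) →L[ℝ] EuclideanSpace ℝ (Fin t) :=
  LinearMap.toContinuousLinearMap (Matrix.toEuclideanLin Rᵀ)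

lemma sketch_apply (R : Matrix (Fin d) (Fin t) ℝ) (x : EuclideanSpace ℝ (Fin d)) (l : Fin t) :
    sketch R x l = ∑ i, x i * R i l := by
  simp [sketch, Matrix.toLpLin_apply, Matrix.mulVec, dotProduct, mul_comm]

/-- The error made by the sketch on an inner product. -/
noncomputable def distortion (R : Matrix (Fin d) (Fin t) ℝ) (x y : EuclideanSpace ℝ (Fin d)) : ℝ :=
  inner ℝ (sketch R x) (sketch R y) - inner ℝ x y

lemma sketch_signMat_apply (s : Fin d → Fin t → Bool) (x : EuclideanSpace ℝ (Fin d)) (l : Fin t) :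
    sketch (signMat s) x l = signedSum x (fun i => s i l) / √(t : ℝ) := by
  rw [sketch_apply, signedSum, sum_div]
  refine sum_congr rfl fun i _ => ?_
  by_cases h : s i l
  · simp [signMat, sign, h, div_eq_mul_inv]
  · simp [signMat, sign, h, div_eq_mul_inv]

lemma mul_distortion_signMat (s : Fin d → Fin t → Bool) (x y : EuclideanSpace ℝ (Fin d)) :
    t * distortion (signMat s) x y = ∑ l, centeredProd x y (fun i => s i l) := by
  have hin : ∀ (m : ℕ) (u v : EuclideanSpace ℝ (Fin m)), inner ℝ u v = ∑ i, u i * v i := by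
    intro m u v
    simp [PiLp.inner_apply, mul_comm]
  rcases Nat.eq_zero_or_pos t with rfl | ht
  · simp
  have ht' : (t : ℝ) ≠ 0 := by positivity
  simp only [distortion, hin, sketch_signMat_apply, centeredProd, sum_sub_distrib, div_mul_div_comm,
    Real.mul_self_sqrt (Nat.cast_nonneg t), ← sum_div, sum_const, card_univ, Fintype.card_fin,
    nsmul_eq_mul]
  field_simp

lemma sum_sq_le_one {m : ℕ} {x : EuclideanSpace ℝ (Fin m)} (hx : ‖x‖ ≤ 1) : ∑ i, x i ^ 2 ≤ 1 := by
  rw [← EuclideanSpace.real_norm_sq_eq]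
  exact pow_le_one₀ (norm_nonneg x) hx

lemma expect_exp_distortion_le {x y : EuclideanSpace ℝ (Fin d)} (hx : ‖x‖ ≤ 1) (hy : ‖y‖ ≤ 1)
    {r : ℝ} (hr : |r| ≤ 1 / 8) :
    𝔼 s : Fin d → Fin t → Bool, Real.exp (r * (t * distortion (signMat s) x y)) ≤
      Real.exp (400 * r ^ 2 * t) := by
  -- Regrouping the signs by columns exhibits the distortion as a sum of `t` independent centred
  -- products.
  rw [Fintype.expect_equiv (Equiv.piComm fun (_ : Fin d) (_ : Fin t) => Bool) _
    (fun s => ∏ l, Real.exp (r * centeredProd x y (s l))) fun s => by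
      rw [mul_distortion_signMat, mul_sum, Real.exp_sum]
      rfl]
  rw [expect_prod_pi fun _ s => Real.exp (r * centeredProd x y s), prod_const, card_univ,
    Fintype.card_fin, mul_comm _ (t : ℝ), Real.exp_nat_mul]
  exact pow_le_pow_left₀ (expect_nonneg fun s _ => (Real.exp_pos _).le)
    (expect_exp_mul_centeredProd_le (sum_sq_le_one hx) (sum_sq_le_one hy) hr) t

lemma freq_distortion_gt_le {x y : EuclideanSpace ℝ (Fin d)} (hx : ‖x‖ ≤ 1) (hy : ‖y‖ ≤ 1)
    {η : ℝ} (ht : 0 < t) (hη : 0 < η) (hη1 : η ≤ 1) :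
    freq {s : Fin d → Fin t → Bool | η < |distortion (signMat s) x y|} ≤
      2 * Real.exp (-(t * η ^ 2 / 1600)) := by
  -- This minimizes the Chernoff exponent `400 * r ^ 2 * t - r * t * η`.
  set r := η / 800 with hr
  have hr0 : 0 ≤ r := by positivity
  have hr8 : |r| ≤ 1 / 8 := by
    rw [abs_of_nonneg (by positivity)]
    linarith
  have one_sided : ∀ r' : ℝ, |r'| = r →
      freq {s : Fin d → Fin t → Bool | Real.exp (r * (t * η)) <
        Real.exp (r' * (t * distortion (signMat s) x y))} ≤ Real.exp (-(t * η ^ 2 / 1600)) := by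
    intro r' hr'
    refine freq_lt_le (fun s => (Real.exp_pos _).le) (Real.exp_pos _).le (Real.exp_pos _).le ?_
    refine (expect_exp_distortion_le hx hy (by rwa [hr', ← abs_of_nonneg hr0])).trans ?_
    rw [← Real.exp_add, Real.exp_le_exp, ← sq_abs, hr', hr]
    apply le_of_eq
    ring
  refine (freq_mono (T := {s : Fin d → Fin t → Bool | Real.exp (r * (t * η)) <
        Real.exp (r * (t * distortion (signMat s) x y))} ∪ {s | Real.exp (r * (t * η)) <
        Real.exp (-r * (t * distortion (signMat s) x y))}) ?_).trans
    ((freq_union_le _ _).trans ?_)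
  · intro s hs
    have hrt : 0 < r * t := by positivity
    rcases lt_abs.1 (show η < |_| from hs) with h | h
    · left
      rw [Set.mem_ofPred_eq, Real.exp_lt_exp, ← mul_assoc, ← mul_assoc]
      exact mul_lt_mul_of_pos_left h hrt
    · right
      rw [Set.mem_ofPred_eq, Real.exp_lt_exp, neg_mul, ← mul_neg, ← mul_neg, ← mul_assoc,
        ← mul_assoc]
      exact mul_lt_mul_of_pos_left h hrt
  · have h1 := one_sided r (abs_of_nonneg hr0)
    have h2 := one_sided (-r) (by rw [abs_neg, abs_of_nonneg hr0])
    linarith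

lemma distortion_smul_smul (R : Matrix (Fin d) (Fin t) ℝ) (a b : ℝ)
    (x y : EuclideanSpace ℝ (Fin d)) :
    distortion R (a • x) (b • y) = a * b * distortion R x y := by
  simp only [distortion, map_smul, real_inner_smul_left, real_inner_smul_right]
  ring

lemma expect_distortion_sq_le_of_norm_le {x y : EuclideanSpace ℝ (Fin d)} (hx : ‖x‖ ≤ 1)
    (hy : ‖y‖ ≤ 1) (ht : 0 < t) :
    𝔼 s : Fin d → Fin t → Bool, distortion (signMat s) x y ^ 2 ≤ 4800 / t := by
  have ht1 : (1 : ℝ) ≤ t := by exact_mod_cast ht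
  have ht0 : (0 : ℝ) < t := by linarith
  have hsq1 : 1 ≤ √(t : ℝ) := Real.one_le_sqrt.2 ht1
  -- Chosen so that `400 * r ^ 2 * t = 1`: both exponential moments are then at most `exp 1 < 3`,
  -- and `4800 = 800 * 6`.
  set r : ℝ := 1 / (20 * √(t : ℝ)) with hr
  have hr0 : 0 ≤ r := by positivity
  have hr8 : |r| ≤ 1 / 8 := by
    rw [abs_of_nonneg hr0, hr]
    exact one_div_le_one_div_of_le (by norm_num) (by linarith)
  have hr2 : r ^ 2 = 1 / (400 * t) := by
    rw [hr, div_pow, mul_pow, Real.sq_sqrt ht0.le]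
    norm_num
  have key : ∀ s : Fin d → Fin t → Bool, distortion (signMat s) x y ^ 2 ≤
      800 / t * (Real.exp (r * (t * distortion (signMat s) x y)) +
        Real.exp (-r * (t * distortion (signMat s) x y))) := by
    intro s
    set D := distortion (signMat s) x y
    set u := r * (t * D) with hu
    have h1 := Real.quadratic_le_exp_of_nonneg (abs_nonneg u)
    rw [sq_abs] at h1
    have h2 : Real.exp |u| ≤ Real.exp u + Real.exp (-u) := by
      rcases abs_choice u with h | h <;> rw [h] <;> linarith [Real.exp_pos u, Real.exp_pos (-u)]
    have h3 : D ^ 2 = 800 / t * (u ^ 2 / 2) := by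
      rw [hu, mul_pow, mul_pow, hr2]
      field_simp
      ring
    rw [h3, neg_mul]
    refine mul_le_mul_of_nonneg_left ?_ (by positivity)
    linarith [abs_nonneg u]
  refine (expect_le_expect fun s _ => key s).trans ?_
  rw [← mul_expect, expect_add_distrib]
  have h1 := expect_exp_distortion_le (t := t) hx hy hr8
  have h2 := expect_exp_distortion_le (t := t) hx hy (r := -r) (by rwa [abs_neg])
  have he : 400 * r ^ 2 * t = 1 := by rw [hr2]; field_simp
  rw [he] at h1
  rw [neg_sq, he] at h2
  have h3 := Real.exp_one_lt_d9
  calc 800 / (t : ℝ) * _ ≤ 800 / t * 6 := mul_le_mul_of_nonneg_left (by linarith) (by positivity)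
    _ = 4800 / t := by ring

/-- The mean squared distortion of the sign sketch. -/
lemma expect_distortion_sq_le (x y : EuclideanSpace ℝ (Fin d)) (ht : 0 < t) :
    𝔼 s : Fin d → Fin t → Bool, distortion (signMat s) x y ^ 2 ≤
      4800 / t * (‖x‖ ^ 2 * ‖y‖ ^ 2) := by
  have hn : ∀ z : EuclideanSpace ℝ (Fin d), ‖z‖ • ‖z‖⁻¹ • z = z := by
    intro z
    rcases eq_or_ne z 0 with rfl | hz
    · simp
    · rw [smul_smul, mul_inv_cancel₀ (norm_ne_zero_iff.2 hz), one_smul]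
  have h1 : ∀ z : EuclideanSpace ℝ (Fin d), ‖‖z‖⁻¹ • z‖ ≤ 1 := by
    intro z
    rw [norm_smul, norm_inv, norm_norm]
    exact inv_mul_le_one
  have h : ∀ s : Fin d → Fin t → Bool, distortion (signMat s) x y ^ 2 =
      distortion (signMat s) (‖x‖⁻¹ • x) (‖y‖⁻¹ • y) ^ 2 * (‖x‖ ^ 2 * ‖y‖ ^ 2) := by
    intro s
    nth_rewrite 1 [← hn x, ← hn y]
    rw [distortion_smul_smul]
    ring
  simp only [h]
  rw [← expect_mul]
  exact mul_le_mul_of_nonneg_right (expect_distortion_sq_le_of_norm_le (h1 x) (h1 y) ht)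
    (by positivity)

/-- With high probability the sketch does not increase the norm of a family of vectors by much. -/
lemma freq_sum_sq_sketch_gt_le {n : ℕ} (m : Fin n → EuclideanSpace ℝ (Fin d)) (ht : 0 < t) {e : ℝ}
    (he : 0 < e) :
    freq {s : Fin d → Fin t → Bool |
      (1 + e) * ∑ i, ‖m i‖ ^ 2 < ∑ i, ‖sketch (signMat s) (m i)‖ ^ 2} ≤ 4800 / (t * e ^ 2) := by
  set F := ∑ i, ‖m i‖ ^ 2 with hF
  have hF0 : 0 ≤ F := sum_nonneg fun i _ => sq_nonneg _
  refine (freq_mono (T := {s | (e * F) ^ 2 < (∑ i, distortion (signMat s) (m i) (m i)) ^ 2})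
    fun s hs => ?_).trans
    (freq_lt_le (fun s => sq_nonneg _) (sq_nonneg _) (by positivity) ?_)
  · rw [Set.mem_ofPred_eq] at hs ⊢
    refine pow_lt_pow_left₀ ?_ (by positivity) two_ne_zero
    simp only [distortion, real_inner_self_eq_norm_sq, sum_sub_distrib]
    linarith
  -- Cauchy–Schwarz with weights `‖m i‖ ^ 2` gives a bound free of `n`. If `m i = 0`, the quotient
  -- `0 / 0` is `0`, as wanted.
  · have key : ∀ s : Fin d → Fin t → Bool, (∑ i, distortion (signMat s) (m i) (m i)) ^ 2 ≤
        F * ∑ i, distortion (signMat s) (m i) (m i) ^ 2 / ‖m i‖ ^ 2 := by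
      intro s
      refine sum_sq_le_sum_mul_sum_of_sq_le_mul _ (fun i _ => sq_nonneg _)
        (fun i _ => by positivity) fun i _ => ?_
      rcases eq_or_ne (m i) 0 with h | h
      · simp [h, distortion]
      · have := norm_pos_iff.2 h
        rw [mul_div_cancel₀ _ (by positivity)]
    refine (expect_le_expect fun s _ => key s).trans ?_
    rw [← mul_expect, expect_sum_comm]
    have h2 : ∑ i, 𝔼 s : Fin d → Fin t → Bool,
        distortion (signMat s) (m i) (m i) ^ 2 / ‖m i‖ ^ 2 ≤ 4800 / t * F := by
      rw [hF, mul_sum]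
      refine sum_le_sum fun i _ => ?_
      rw [← expect_div]
      rcases eq_or_ne (m i) 0 with h | h
      · simp [h]
      · have := norm_pos_iff.2 h
        rw [div_le_iff₀ (by positivity), mul_assoc]
        exact expect_distortion_sq_le (m i) (m i) ht
    refine (mul_le_mul_of_nonneg_left h2 hF0).trans (le_of_eq ?_)
    field_simp

/-- With high probability the sketch nearly preserves the inner products between two families. -/
lemma freq_sum_distortion_sq_gt_le {n k : ℕ} (b : Fin n → EuclideanSpace ℝ (Fin d))
    (v : Fin k → EuclideanSpace ℝ (Fin d)) (hv : ∀ j, ‖v j‖ ≤ 1) (ht : 0 < t) {e : ℝ}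
    (he : 0 < e) :
    freq {s : Fin d → Fin t → Bool |
      e ^ 2 * ∑ i, ‖b i‖ ^ 2 < ∑ i, ∑ j, distortion (signMat s) (v j) (b i) ^ 2} ≤
      4800 * k / (t * e ^ 2) := by
  refine freq_lt_le (fun s => by positivity) (by positivity) (by positivity) ?_
  simp only [expect_sum_comm]
  have h : ∀ i j, 𝔼 s : Fin d → Fin t → Bool, distortion (signMat s) (v j) (b i) ^ 2 ≤
      4800 / t * ‖b i‖ ^ 2 := fun i j => by
    refine (expect_distortion_sq_le _ _ ht).trans
      (mul_le_mul_of_nonneg_left ?_ (by positivity))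
    exact mul_le_of_le_one_left (sq_nonneg _) (pow_le_one₀ (norm_nonneg _) (hv j))
  refine (sum_le_sum fun i _ => sum_le_sum fun j _ => h i j).trans (le_of_eq ?_)
  simp only [sum_const, card_univ, Fintype.card_fin, nsmul_eq_mul, ← mul_sum]
  field_simp

/-- With high probability the sketch nearly preserves all inner products in a subspace. -/
lemma freq_exists_distortion_gt_le (V : Submodule ℝ (EuclideanSpace ℝ (Fin d))) {k : ℕ}
    (hV : Module.finrank ℝ V ≤ k) (ht : 0 < t) {e : ℝ} (he : 0 < e) (he1 : e ≤ 1) :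
    freq {s : Fin d → Fin t → Bool |
      ∃ x ∈ V, ∃ y ∈ V, e * ‖x‖ * ‖y‖ < |distortion (signMat s) x y|} ≤
      25 ^ k * (2 * Real.exp (-(t * (e / 4) ^ 2 / 1600))) := by
  classical
  obtain ⟨N, hcard, hN2, hN⟩ := exists_net_card_le V
  -- Net points have norm up to `2`; halving both brings them into the unit ball and turns the
  -- threshold `e` into `e / 4`.
  set B : V × V → Set (Fin d → Fin t → Bool) := fun p => {s | e / 4 <
    |distortion (signMat s) ((1 / 2 : ℝ) • (p.1 : EuclideanSpace ℝ (Fin d))) ((1 / 2 : ℝ) • p.2)|}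
  have hB : ∀ p ∈ N ×ˢ N, freq (B p) ≤ 2 * Real.exp (-(t * (e / 4) ^ 2 / 1600)) := by
    intro p hp
    have hhalf : ∀ c ∈ N, ‖(1 / 2 : ℝ) • (c : EuclideanSpace ℝ (Fin d))‖ ≤ 1 := by
      intro c hc
      have := hN2 c hc
      rw [norm_smul, Submodule.coe_norm] at *
      norm_num
      linarith
    rw [mem_product] at hp
    exact freq_distortion_gt_le (hhalf _ hp.1) (hhalf _ hp.2) ht (by positivity) (by linarith)
  refine (freq_mono (T := ⋃ p ∈ N ×ˢ N, B p) fun s hs => ?_).trans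
    ((freq_biUnion_le _ _).trans ((sum_le_sum hB).trans ?_))
  · by_contra hns
    obtain ⟨x, hx, y, hy, hxy⟩ := hs
    let L : V →L[ℝ] EuclideanSpace ℝ (Fin t) := (sketch (signMat s)).comp V.subtypeL
    let f : V →L[ℝ] V →L[ℝ] ℝ := (innerSL ℝ).bilinearComp L L - innerSL ℝ
    have hf : ∀ u v : V, f u v = distortion (signMat s) u v := fun u v => rfl
    have := abs_bilin_le_of_net hN f he.le (fun c hc c' hc' => ?_) ⟨x, hx⟩ ⟨y, hy⟩
    · exact absurd this (not_le.2 hxy)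
    · simp only [Set.mem_iUnion, not_exists] at hns
      have h := hns (c, c') (mem_product.2 ⟨hc, hc'⟩)
      rw [Set.mem_ofPred_eq, not_lt, distortion_smul_smul, abs_mul] at h
      rw [hf]
      norm_num at h
      linarith
  · rw [sum_const, nsmul_eq_mul, card_product]
    refine mul_le_mul_of_nonneg_right ?_ (by positivity)
    have h5 : N.card ≤ 5 ^ k := hcard.trans (Nat.pow_le_pow_right (by norm_num) hV)
    have : N.card * N.card ≤ 25 ^ k := by
      calc N.card * N.card ≤ 5 ^ k * 5 ^ k := Nat.mul_le_mul h5 h5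
        _ = 25 ^ k := by rw [← mul_pow]; norm_num
    exact_mod_cast this

end Sketch

/-! ### Indicator matrices -/

section Residual

variable {n k : ℕ}

lemma IsIndicator.sum_mul_eq {X : Matrix (Fin n) (Fin k) ℝ} (hX : IsIndicator X) (c c' : Fin k) :
    ∑ i, X i c * X i c' = if c = c' then 1 else 0 := by
  classical
  split_ifs with h
  · subst h
    have hcard : (cluster X c).ncard = #{i | X i c ≠ 0} := by
      rw [← Set.ncard_coe_finset]
      congr 1
      ext i
      simp [cluster]
    have hpos : (0 : ℝ) < (cluster X c).ncard := by
      exact_mod_cast (Set.ncard_pos (Set.toFinite _)).2 (hX.cluster_nonempty c)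
    have hterm : ∀ i, X i c * X i c = if X i c ≠ 0 then 1 / ((cluster X c).ncard : ℝ) else 0 := by
      intro i
      split_ifs with hi
      · rw [hX.entry_eq i c hi, div_mul_div_comm, Real.mul_self_sqrt hpos.le, one_mul]
      · rw [not_not.1 hi, mul_zero]
    rw [sum_congr rfl fun i _ => hterm i, ← sum_filter, sum_const, ← hcard, nsmul_eq_mul,
      mul_one_div_cancel hpos.ne']
  · refine sum_eq_zero fun i _ => ?_
    by_contra hne
    exact h ((hX.existsUnique_ne_zero i).unique (left_ne_zero_of_mul hne)
      (right_ne_zero_of_mul hne))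

variable {E H : Type*} [NormedAddCommGroup E] [InnerProductSpace ℝ E] [NormedAddCommGroup H]
  [InnerProductSpace ℝ H]

/-- The unnormalized centroids `∑ i, X i c • f i` of a family of points. -/
def centroid (X : Indicator n k) (f : Fin n → E) (c : Fin k) : E := ∑ i, X.1 i c • f i

/-- The family `(1 - X Xᵀ) f`, for a family `f` of vectors. -/
def residual (X : Indicator n k) (f : Fin n → E) (i : Fin n) : E :=
  f i - ∑ c, X.1 i c • centroid X f c

/-- `1 - X Xᵀ` mixes the points while `L` acts on each of them, so the two commute. This is used for
the sketch, the projection off `V` and the functionals `⟨L (v j), L ·⟩`. -/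
lemma map_residual (X : Indicator n k) (L : E →ₗ[ℝ] H) (f : Fin n → E) (i : Fin n) :
    L (residual X f i) = residual X (fun i => L (f i)) i := by
  simp [residual, centroid, map_sum, map_sub, map_smul]

/-- As `Xᵀ X = 1`, the matrix `X Xᵀ` is an orthogonal projection, and the sum drops by exactly `∑ c,
‖g c‖ ^ 2`. -/
lemma sum_norm_sq_residual_le (X : Indicator n k) (f : Fin n → E) :
    ∑ i, ‖residual X f i‖ ^ 2 ≤ ∑ i, ‖f i‖ ^ 2 := by
  set g := centroid X f with hg
  have h1 : ∑ i, inner ℝ (f i) (∑ c, X.1 i c • g c) = ∑ c, ‖g c‖ ^ 2 := by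
    simp only [inner_sum, real_inner_smul_right]
    rw [sum_comm]
    refine sum_congr rfl fun c _ => ?_
    rw [← real_inner_self_eq_norm_sq]
    nth_rewrite 2 [hg]
    simp only [centroid, sum_inner, real_inner_smul_left]
  have h2 : ∑ i, ‖∑ c, X.1 i c • g c‖ ^ 2 = ∑ c, ‖g c‖ ^ 2 := by
    have : ∀ i, ‖∑ c, X.1 i c • g c‖ ^ 2 =
        ∑ c, ∑ c', X.1 i c * X.1 i c' * inner ℝ (g c) (g c') := by
      intro i
      rw [← real_inner_self_eq_norm_sq]
      simp only [sum_inner, inner_sum, real_inner_smul_left, real_inner_smul_right]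
      exact sum_congr rfl fun c _ => sum_congr rfl fun c' _ => by
        rw [real_inner_comm]
        ring
    simp only [this]
    rw [sum_comm]
    refine sum_congr rfl fun c _ => ?_
    rw [sum_comm]
    simp only [← sum_mul, X.2.sum_mul_eq, ite_mul, one_mul, zero_mul, sum_ite_eq, mem_univ,
      if_true, real_inner_self_eq_norm_sq]
  have h3 : ∑ i, ‖residual X f i‖ ^ 2 = ∑ i, ‖f i‖ ^ 2 - ∑ c, ‖g c‖ ^ 2 := by
    simp only [residual, norm_sub_sq_real, sum_add_distrib, sum_sub_distrib, ← mul_sum]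
    rw [h1, h2]
    ring
  rw [h3]
  linarith [sum_nonneg fun c (_ : c ∈ univ) => sq_nonneg ‖g c‖]

end Residual

/-! ### The rows of a matrix -/

section Rows

variable {n m d t k : ℕ}

/-- The `i`-th row of a matrix, as a vector in Euclidean space. -/
def row (A : Matrix (Fin n) (Fin m) ℝ) (i : Fin n) : EuclideanSpace ℝ (Fin m) := WithLp.toLp 2 (A i)

section Frobenius

attribute [local instance] Matrix.frobeniusNormedAddCommGroup

lemma cost_eq_sum (A : Matrix (Fin n) (Fin m) ℝ) (X : Indicator n k) :
    cost A X = ∑ i, ‖residual X (row A) i‖ ^ 2 := by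
  rw [cost, Matrix.frobenius_norm_def, ← Real.sqrt_eq_rpow, Real.sq_sqrt (by positivity)]
  refine sum_congr rfl fun i _ => ?_
  rw [EuclideanSpace.norm_sq_eq]
  refine sum_congr rfl fun j _ => ?_
  suffices h : (A - X.1 * X.1ᵀ * A) i j = residual X (row A) i j by rw [h, Real.rpow_two]
  simp [residual, centroid, row, Matrix.sub_apply, Matrix.mul_assoc, Matrix.mul_apply]

end Frobenius

lemma row_mul (A : Matrix (Fin n) (Fin d) ℝ) (R : Matrix (Fin d) (Fin t) ℝ) (i : Fin n) :
    row (A * R) i = sketch R (row A i) := by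
  ext l
  rw [sketch_apply]
  simp [row, Matrix.mul_apply]

lemma cost_mul_eq_sum (A : Matrix (Fin n) (Fin d) ℝ) (R : Matrix (Fin d) (Fin t) ℝ)
    (X : Indicator n k) :
    cost (A * R) X = ∑ i, ‖sketch R (residual X (row A) i)‖ ^ 2 := by
  rw [cost_eq_sum]
  refine sum_congr rfl fun i _ => ?_
  have := map_residual X (sketch R).toLinearMap (row A) i
  simp only [ContinuousLinearMap.coe_coe] at this
  rw [this]
  simp only [residual, centroid, row_mul]

end Rows

/-! ### The deterministic part of the argument -/

section Deterministic

/-- Here `N`, `r`, `μ` and `f` stand for `‖P m‖`, `‖L P m‖`, `‖L m‖` and `√F`. Since `γ ≥ 1`, the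
cross term is absorbed into `g = √γ * f`; dividing `h2` by `r` gives `r ≤ (1 + e + (30 / 29) * e) *
g`, rounded up to `2.1`. -/
lemma sq_le_of_sketch_bounds {N r μ f γ e : ℝ} (hN : 0 ≤ N) (hr : 0 ≤ r) (hf : 0 ≤ f)
    (hγ : 1 ≤ γ) (he : 0 < e) (he1 : e ≤ 1 / 30) (h1 : (1 - e) * N ^ 2 ≤ r ^ 2)
    (h2 : r ^ 2 ≤ r * μ + e * f * N) (h3 : μ ^ 2 ≤ γ * (1 + e) * f ^ 2) :
    N ^ 2 ≤ (1 + 10 * e) * γ * f ^ 2 := by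
  set g := √γ * f with hg
  have hg2 : g ^ 2 = γ * f ^ 2 := by rw [hg, mul_pow, Real.sq_sqrt (by linarith)]
  have hfg : f ≤ g := le_mul_of_one_le_left hf (Real.one_le_sqrt.2 hγ)
  have hg0 : 0 ≤ g := hf.trans hfg
  have hμ : μ ≤ (1 + e) * g := by
    refine le_of_sq_le_sq ?_ (by positivity)
    rw [mul_pow, hg2]
    have : 0 ≤ γ * f ^ 2 := by positivity
    nlinarith
  have hNr : (29 / 30) * N ≤ r := by
    refine le_of_sq_le_sq ?_ hr
    nlinarith [sq_nonneg N]
  have hfN : e * f * N ≤ e * g * ((30 / 29) * r) := by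
    refine mul_le_mul ?_ (by linarith) hN (by positivity)
    exact mul_le_mul_of_nonneg_left hfg he.le
  have hrg : r ≤ (1 + 2.1 * e) * g := by
    rcases hr.eq_or_lt with h | h
    · rw [← h]
      positivity
    · refine le_of_mul_le_mul_left ?_ h
      have := mul_le_mul_of_nonneg_left hμ hr
      have : 0 ≤ e * g * r := by positivity
      nlinarith
  have h5 : r ^ 2 ≤ (1 + 2.1 * e) ^ 2 * g ^ 2 := by
    rw [← mul_pow]
    exact pow_le_pow_left₀ hr hrg 2
  rw [mul_assoc, ← hg2]
  have h6 : (1 + 2.1 * e) ^ 2 ≤ (1 - e) * (1 + 10 * e) := by nlinarith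
  refine le_of_mul_le_mul_left ?_ (by linarith : 0 < 1 - e)
  calc (1 - e) * N ^ 2 ≤ (1 + 2.1 * e) ^ 2 * g ^ 2 := h1.trans h5
    _ ≤ (1 - e) * (1 + 10 * e) * g ^ 2 := mul_le_mul_of_nonneg_right h6 (sq_nonneg g)
    _ = _ := by ring

variable {E H : Type*} [NormedAddCommGroup E] [InnerProductSpace ℝ E] [NormedAddCommGroup H]
  [InnerProductSpace ℝ H] {n k q : ℕ}

/-- Cauchy–Schwarz for families of vectors. -/
lemma sum_inner_le_sqrt_mul_sqrt (f g : Fin n → H) :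
    ∑ i, inner ℝ (f i) (g i) ≤ √(∑ i, ‖f i‖ ^ 2) * √(∑ i, ‖g i‖ ^ 2) :=
  (sum_le_sum fun i _ => real_inner_le_norm (f i) (g i)).trans
    (Real.sum_mul_le_sqrt_mul_sqrt univ (fun i => ‖f i‖) fun i => ‖g i‖)

/-- If a linear map `L` is nearly isometric on a subspace `V` that captures the points `a` up to `F`
and nearly preserves the orthogonality between `V` and the parts of the points outside of `V`, then
a clustering that is cheap for `L a` is cheap for `a`. -/
lemma sum_norm_sq_residual_le_of_sketch (L : E →L[ℝ] H) (V : Submodule ℝ E)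
    [FiniteDimensional ℝ V] (v : OrthonormalBasis (Fin q) ℝ V) (a : Fin n → E) (X : Indicator n k)
    {F γ e : ℝ} (hγ : 1 ≤ γ) (he : 0 < e) (he1 : e ≤ 1 / 30)
    (hV : ∀ x ∈ V, (1 - e) * ‖x‖ ^ 2 ≤ ‖L x‖ ^ 2)
    (hb : ∑ i, ‖a i - V.starProjection (a i)‖ ^ 2 ≤ F)
    (hcross : ∑ i, ∑ j, inner ℝ (L (v j)) (L (a i - V.starProjection (a i))) ^ 2 ≤ e ^ 2 * F)
    (hcost : ∑ i, ‖L (residual X a i)‖ ^ 2 ≤ γ * (1 + e) * F) :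
    ∑ i, ‖residual X a i‖ ^ 2 ≤ (1 + (1 + 10 * e) * γ) * F := by
  set P := V.starProjection
  set m := residual X a with hm
  set b : Fin n → E := fun i => a i - P (a i) with hbdef
  have hF : 0 ≤ F := le_trans (by positivity) hb
  have hy : ∀ i, m i - P (m i) = residual X b i := by
    intro i
    have := map_residual X (LinearMap.id - P.toLinearMap) a i
    simpa using this
  have hsplit : ∑ i, ‖m i‖ ^ 2 = ∑ i, ‖P (m i)‖ ^ 2 + ∑ i, ‖residual X b i‖ ^ 2 := by
    rw [← sum_add_distrib]
    refine sum_congr rfl fun i _ => ?_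
    rw [Submodule.norm_sq_eq_add_norm_sq_starProjection (m i) V, ← hy,
      Submodule.starProjection_orthogonal_val]
  have hout : ∑ i, ‖residual X b i‖ ^ 2 ≤ F := (sum_norm_sq_residual_le X b).trans hb
  have hmem : ∀ i, P (m i) ∈ V := fun i => V.starProjection_apply_mem (m i)
  set w : Fin n → V := fun i => ⟨P (m i), hmem i⟩ with hw
  -- For each `j`, the contraction `1 - X Xᵀ` is applied to the scalars `⟨L (v j), L (b i)⟩`. Thus a
  -- bound on `b` alone serves every `X`.
  have hcross' : ∑ p : Fin n × Fin q, inner ℝ (L (v p.2)) (L (residual X b p.1)) ^ 2 ≤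
      e ^ 2 * F := by
    refine le_trans ?_ hcross
    rw [Fintype.sum_prod_type, sum_comm]
    nth_rewrite 2 [sum_comm]
    refine sum_le_sum fun j _ => ?_
    have h := sum_norm_sq_residual_le X fun i => inner ℝ (L (v j)) (L (b i))
    have h' : ∀ i, inner ℝ (L (v j)) (L (residual X b i)) =
        residual X (fun i => inner ℝ (L (v j)) (L (b i))) i := fun i =>
      map_residual X ((innerSL ℝ (L (v j))).comp L).toLinearMap b i
    simpa only [h', Real.norm_eq_abs, sq_abs] using h
  have hexp : ∀ i, inner ℝ (L (P (m i))) (L (residual X b i)) =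
      ∑ j, inner ℝ (v j) (w i) * inner ℝ (L (v j)) (L (residual X b i)) := by
    intro i
    have h : P (m i) = ∑ j, (inner ℝ (v j) (w i) : ℝ) • (v j : E) := by
      have := congrArg (Subtype.val) (v.sum_repr' (w i))
      simpa [hw] using this.symm
    nth_rewrite 1 [h]
    simp only [map_sum, map_smul, sum_inner, real_inner_smul_left]
  -- Cauchy–Schwarz over the pairs `(i, j)`, after expanding `P (m i)` in the orthonormal basis `v`.
  have hinner : -(e * √F * √(∑ i, ‖P (m i)‖ ^ 2)) ≤
      ∑ i, inner ℝ (L (P (m i))) (L (residual X b i)) := by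
    simp only [hexp]
    rw [← Fintype.sum_prod_type']
    refine neg_le_of_abs_le (abs_le_of_sq_le_sq ?_ (by positivity))
    refine (sum_mul_sq_le_sq_mul_sq _ _ _).trans ?_
    rw [mul_pow, mul_pow, Real.sq_sqrt hF, Real.sq_sqrt (by positivity), mul_comm]
    refine mul_le_mul hcross' (le_of_eq ?_) (by positivity) (by positivity)
    rw [Fintype.sum_prod_type]
    refine sum_congr rfl fun i _ => ?_
    have := v.sum_sq_norm_inner_right (w i)
    simpa [hw] using this
  have hlow : (1 - e) * √(∑ i, ‖P (m i)‖ ^ 2) ^ 2 ≤ √(∑ i, ‖L (P (m i))‖ ^ 2) ^ 2 := by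
    rw [Real.sq_sqrt (by positivity), Real.sq_sqrt (by positivity), mul_sum]
    exact sum_le_sum fun i _ => hV _ (hmem i)
  have hquad : √(∑ i, ‖L (P (m i))‖ ^ 2) ^ 2 ≤
      √(∑ i, ‖L (P (m i))‖ ^ 2) * √(∑ i, ‖L (m i)‖ ^ 2) + e * √F * √(∑ i, ‖P (m i)‖ ^ 2) := by
    rw [Real.sq_sqrt (by positivity)]
    have h1 := sum_inner_le_sqrt_mul_sqrt (fun i => L (P (m i))) fun i => L (m i)
    have h2 : ∑ i, inner ℝ (L (P (m i))) (L (m i)) = ∑ i, ‖L (P (m i))‖ ^ 2 +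
        ∑ i, inner ℝ (L (P (m i))) (L (residual X b i)) := by
      rw [← sum_add_distrib]
      refine sum_congr rfl fun i _ => ?_
      rw [← hy, map_sub, inner_sub_right, real_inner_self_eq_norm_sq]
      ring
    linarith
  have hfin := sq_le_of_sketch_bounds (μ := √(∑ i, ‖L (m i)‖ ^ 2)) (Real.sqrt_nonneg _)
    (Real.sqrt_nonneg _) (Real.sqrt_nonneg F) hγ he he1 hlow hquad (by
      rwa [Real.sq_sqrt (by positivity), Real.sq_sqrt hF])
  rw [Real.sq_sqrt (by positivity), Real.sq_sqrt hF] at hfin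
  rw [hsplit]
  linarith

end Deterministic

/-! ### Discrete laws -/

section Law

lemma toOuterMeasure_ne_top {α : Type*} (p : PMF α) (S : Set α) : p.toOuterMeasure S ≠ ⊤ := by
  rw [PMF.toOuterMeasure_apply]
  exact p.tsum_coe_indicator_ne_top S

lemma prob_mono {α : Type*} (p : PMF α) {S T : Set α} (h : S ⊆ T) : prob p S ≤ prob p T :=
  ENNReal.toReal_mono (toOuterMeasure_ne_top p T) (p.toOuterMeasure.mono h)

lemma prob_signMatrix {d t : ℕ} (S : Set (Matrix (Fin d) (Fin t) ℝ)) :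
    prob (signMatrix d t) S = freq {s : Fin d → Fin t → Bool | signMat s ∈ S} := by
  classical
  have h : (signMatrix d t).toOuterMeasure S =
      (PMF.uniformOfFintype (Fin d → Fin t → Bool)).toOuterMeasure {s | signMat s ∈ S} :=
    PMF.toOuterMeasure_map_apply _ _ _
  rw [prob, h, PMF.toOuterMeasure_uniformOfFintype_apply, ENNReal.toReal_div,
    ENNReal.toReal_natCast, ENNReal.toReal_natCast, freq, Fintype.expect_eq_sum_div_card, sum_boole,
    Fintype.card_subtype]

lemma mul_prob_le_prob_bind {α β : Type*} (p : PMF α) (f : α → PMF β) {G : Set α} {T : Set β}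
    {q : ℝ} (hq : 0 ≤ q) (h : ∀ a ∈ G, q ≤ prob (f a) T) : prob p G * q ≤ prob (p.bind f) T := by
  classical
  rw [← ENNReal.toReal_ofReal hq, prob, prob, ← ENNReal.toReal_mul]
  refine ENNReal.toReal_mono (toOuterMeasure_ne_top _ _) ?_
  rw [PMF.toOuterMeasure_bind_apply, PMF.toOuterMeasure_apply, ← ENNReal.tsum_mul_right]
  refine ENNReal.tsum_le_tsum fun a => ?_
  by_cases ha : a ∈ G
  · rw [Set.indicator_of_mem ha]
    exact mul_le_mul_right (ENNReal.ofReal_le_of_le_toReal (h a ha)) _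
  · rw [Set.indicator_of_notMem ha, zero_mul]
    exact zero_le

end Law

/-! ### Random projections for `k`-means -/

section Main

variable {n d k t : ℕ}

/-- The sketches for which every clustering that is approximately optimal on the sketched points is
approximately optimal on the original points. -/
def goodSketches (A : Matrix (Fin n) (Fin d) ℝ) (Xopt : Indicator n k) (ε : ℝ) (t : ℕ) :
    Set (Matrix (Fin d) (Fin t) ℝ) :=
  {R | ∀ γ : ℝ, 1 ≤ γ → ∀ X : Indicator n k, cost (A * R) X ≤ γ * cost (A * R) Xopt →
    cost A X ≤ (1 + (1 + ε) * γ) * cost A Xopt}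

lemma pow_mul_exp_le {x : ℝ} (hk : 0 < k) (hx : 10 * k ≤ x) :
    25 ^ k * (2 * Real.exp (-x)) ≤ 0.01 := by
  have h1 : (5000 : ℝ) ≤ Real.exp 10 := by
    have h : Real.exp 10 = Real.exp 1 ^ 10 := by rw [← Real.exp_nat_mul]; norm_num
    rw [h]
    have := pow_le_pow_left₀ (by norm_num) Real.exp_one_gt_d9.le 10
    exact le_trans (by norm_num) this
  have h2 : Real.exp (-x) ≤ (Real.exp (-10)) ^ k := by
    rw [← Real.exp_nat_mul, Real.exp_le_exp]
    linarith
  have h3 : 25 * Real.exp (-10) ≤ 0.005 := by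
    rw [Real.exp_neg, ← div_eq_mul_inv, div_le_iff₀ (by positivity)]
    linarith
  calc (25 : ℝ) ^ k * (2 * Real.exp (-x)) ≤ 25 ^ k * (2 * Real.exp (-10) ^ k) := by gcongr
    _ = 2 * (25 * Real.exp (-10)) ^ k := by rw [mul_pow]; ring
    _ ≤ 2 * (0.005 : ℝ) ^ k := by gcongr
    _ ≤ 2 * (0.005 : ℝ) ^ 1 := by
        gcongr ?_ * ?_
        exact pow_le_pow_of_le_one (by norm_num) (by norm_num) hk
    _ = 0.01 := by norm_num

lemma le_prob_goodSketches (A : Matrix (Fin n) (Fin d) ℝ) (hk : 0 < k) {ε : ℝ} (hε : 0 < ε)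
    (hε1 : ε < 1 / 3) (ht : 5 * 10 ^ 7 * (k : ℝ) / ε ^ 2 ≤ t) (Xopt : Indicator n k) :
    0.97 ≤ prob (signMatrix d t) (goodSketches A Xopt ε t) := by
  classical
  rw [div_le_iff₀ (by positivity)] at ht
  have hk1 : (1 : ℝ) ≤ k := by exact_mod_cast hk
  have ht0 : 0 < t := by
    rcases Nat.eq_zero_or_pos t with rfl | h
    · rw [Nat.cast_zero, zero_mul] at ht
      linarith
    · exact h
  have ht0' : (0 : ℝ) < t := by exact_mod_cast ht0
  set e := ε / 10 with he
  have he0 : 0 < e := by positivity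
  -- This makes `4800 * k / (t * e ^ 2) ≤ 0.01` and the net exponent `t * e ^ 2 / 25600` at least
  -- `10 * k`, enough to beat `25 ^ k`.
  have hte : 5 * 10 ^ 5 * (k : ℝ) ≤ t * e ^ 2 := by
    rw [he, div_pow]
    linarith
  have hte0 : 0 < t * e ^ 2 := by positivity
  let a := row A
  let V : Submodule ℝ (EuclideanSpace ℝ (Fin d)) :=
    Submodule.span ℝ (Set.range (centroid Xopt a))
  have hVk : Module.finrank ℝ V ≤ k := by
    have := finrank_range_le_card (R := ℝ) (centroid Xopt a)
    rwa [Fintype.card_fin] at this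
  let v := stdOrthonormalBasis ℝ V
  set b : Fin n → EuclideanSpace ℝ (Fin d) := fun i => a i - V.starProjection (a i) with hb
  let B₁ : Set (Fin d → Fin t → Bool) := {s | (1 + e) * ∑ i, ‖residual Xopt a i‖ ^ 2 <
    ∑ i, ‖sketch (signMat s) (residual Xopt a i)‖ ^ 2}
  let B₂ : Set (Fin d → Fin t → Bool) :=
    {s | ∃ x ∈ V, ∃ y ∈ V, e * ‖x‖ * ‖y‖ < |distortion (signMat s) x y|}
  let B₃ : Set (Fin d → Fin t → Bool) := {s | e ^ 2 * ∑ i, ‖b i‖ ^ 2 <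
    ∑ i, ∑ j, distortion (signMat s) (v j) (b i) ^ 2}
  have h₁ : freq B₁ ≤ 0.01 := by
    refine (freq_sum_sq_sketch_gt_le _ ht0 he0).trans ?_
    rw [div_le_iff₀ hte0]
    linarith
  have h₂ : freq B₂ ≤ 0.01 := by
    refine (freq_exists_distortion_gt_le V hVk ht0 he0 (by linarith)).trans
      (pow_mul_exp_le hk ?_)
    rw [div_pow]
    linarith
  have h₃ : freq B₃ ≤ 0.01 := by
    refine (freq_sum_distortion_sq_gt_le b (fun j => (v j : EuclideanSpace ℝ (Fin d)))
      (fun j => (v.norm_eq_one j).le) ht0 he0).trans ?_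
    rw [div_le_iff₀ hte0]
    have : (Module.finrank ℝ V : ℝ) ≤ k := by exact_mod_cast hVk
    linarith
  have hbF : ∑ i, ‖b i‖ ^ 2 ≤ cost A Xopt := by
    rw [cost_eq_sum]
    refine sum_le_sum fun i _ => pow_le_pow_left₀ (norm_nonneg _) ?_ 2
    have hmem : ∑ c, Xopt.1 i c • centroid Xopt a c ∈ V :=
      V.sum_mem fun c _ => V.smul_mem _ (Submodule.subset_span ⟨c, rfl⟩)
    rw [hb]
    dsimp only
    -- The projection onto `V` is the nearest point, so it does at least as well as the assigned
    -- centre, which lies in `V`.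
    rw [V.starProjection_minimal (a i)]
    exact ciInf_le ⟨0, by rintro _ ⟨x, rfl⟩; exact norm_nonneg _⟩
      (⟨_, hmem⟩ : V)
  have hgood : (B₁ ∪ B₂ ∪ B₃)ᶜ ⊆ {s | signMat s ∈ goodSketches A Xopt ε t} := by
    intro s hs γ hγ X hX
    simp only [Set.mem_compl_iff, Set.mem_union, not_or] at hs
    obtain ⟨⟨hs₁, hs₂⟩, hs₃⟩ := hs
    simp only [B₁, B₂, B₃, Set.mem_ofPred_eq, not_lt, not_exists, not_and] at hs₁ hs₂ hs₃
    have h10 : (1 + (1 + ε) * γ) = (1 + (1 + 10 * e) * γ) := by rw [he]; ring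
    rw [cost_eq_sum A X, h10]
    refine sum_norm_sq_residual_le_of_sketch (sketch (signMat s)) V v a X hγ he0 (by linarith)
      (fun x hx => ?_) hbF ?_ ?_
    · have h := (abs_le.1 (hs₂ x hx x hx)).1
      rw [distortion, real_inner_self_eq_norm_sq, real_inner_self_eq_norm_sq] at h
      nlinarith
    · refine le_trans (le_of_eq ?_) (hs₃.trans (mul_le_mul_of_nonneg_left hbF (sq_nonneg e)))
      refine sum_congr rfl fun i _ => sum_congr rfl fun j _ => ?_
      have : inner ℝ (v j : EuclideanSpace ℝ (Fin d)) (b i) = 0 := by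
        rw [real_inner_comm]
        exact V.starProjection_inner_eq_zero (a i) _ (v j).2
      rw [distortion, this, sub_zero]
    · rw [cost_mul_eq_sum, cost_mul_eq_sum] at hX
      refine hX.trans ?_
      rw [mul_assoc, cost_eq_sum]
      exact mul_le_mul_of_nonneg_left hs₁ (by linarith)
  rw [prob_signMatrix]
  refine le_trans ?_ (freq_mono hgood)
  rw [freq_compl]
  have h := freq_union_le (B₁ ∪ B₂) B₃
  have h' := freq_union_le B₁ B₂
  linarith

end Main

end KMeansRP

open KMeansRP in
theorem theorem1 :
    ∃ c : ℝ, 0 < c ∧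
      ∀ (n d k : ℕ) (A : Matrix (Fin n) (Fin d) ℝ), 0 < k → k < min n d →
      ∀ ε : ℝ, 0 < ε → ε < 1 / 3 →
      ∀ t : ℕ, c * (k : ℝ) / ε ^ 2 ≤ (t : ℝ) →
        (∀ (γ δ : ℝ), 1 ≤ γ → 0 ≤ δ → δ < 1 →
          ∀ alg : Algorithm n t k, IsApproximation alg γ δ →
          ∀ Xopt : Indicator n k, IsOptimal A Xopt →
            0.97 - δ ≤ prob (projectAndCluster alg A)
              {X | cost A X ≤ (1 + (1 + ε) * γ) * cost A Xopt}) ∧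
        0.97 ≤ prob (signMatrix d t) {R | PreservesClustering k A (A * R) (2 + ε)} := by
  refine ⟨5 * 10 ^ 7, by norm_num, fun n d k A hk _ ε hε hε1 t ht => ⟨?_, ?_⟩⟩
  · intro γ δ hγ hδ hδ1 alg halg Xopt _
    have hgood := le_prob_goodSketches A hk hε hε1 ht Xopt
    -- Conditionally on a good `R`, the algorithm succeeds with probability at least `1 - δ`, and
    -- `0.97 * (1 - δ) ≥ 0.97 - δ`.
    refine le_trans ?_ (mul_prob_le_prob_bind (signMatrix d t) (fun R => alg (A * R))
      (G := goodSketches A Xopt ε t) (sub_nonneg.2 hδ1.le) fun R hR =>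
        (halg (A * R)).trans (prob_mono _ fun X hX => hR γ hγ X (hX Xopt)))
    nlinarith
  · by_cases hopt : ∃ Xopt : Indicator n k, IsOptimal A Xopt
    -- One reference optimum suffices: its good event, used with `γ = 1`, bounds the cost against
    -- every other optimum too.
    · obtain ⟨X₀, hX₀⟩ := hopt
      refine (le_prob_goodSketches A hk hε hε1 ht X₀).trans (prob_mono _ fun R hR X Xopt hX _ => ?_)
      have h := hR 1 le_rfl X (by rw [one_mul]; exact hX X₀)
      have hle : cost A X₀ ≤ cost A Xopt := hX₀ Xopt
      calc cost A X ≤ (2 + ε) * cost A X₀ := by linarith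
        _ ≤ (2 + ε) * cost A Xopt := mul_le_mul_of_nonneg_left hle (by linarith)
    -- Without an optimum for `A` the property is vacuous and holds for every `R`.
    · have h : {R : Matrix (Fin d) (Fin t) ℝ | PreservesClustering k A (A * R) (2 + ε)} =
          Set.univ :=
        Set.eq_univ_of_forall fun R X Xopt _ hX => absurd ⟨Xopt, hX⟩ hopt
      rw [h, prob, (PMF.toOuterMeasure_apply_eq_one_iff _ _).2 (Set.subset_univ _)]
      norm_num
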